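/- Let $\Gamma=\mathbb Z^2$. A *dilation datum* $(G,d,(D_\lambda)_{\lambda>0},\Gamma,V)$ consists of a connected and simply connected topological group $G$ whose topology is induced by a proper left-invariant metric $d$; a one-parameter group $(D_\lambda)_{\lambda>0}$ of automorphisms of $G$ with $d(D_\lambda g,D_\lambda h)=\lambda\, d(g,h)$; an embedding of $\Gamma$ into $G$ as a discrete co-compact subgroup such that $D_\lambda[\Gamma]\subseteq\Gamma$ for some $\lambda>1$; and a relatively compact Borel set $V\subseteq G$ containing $e$ in its interior with $G=\bigsqcup_{\gamma\in\Gamma}\gamma V$. For $\lambda>1$ put $V_\lambda(0)=V$ and $V_\lambda(n+1)=D_\lambda[(V_\lambda(n)\cap\Gamma)V]$. A *stretch factor* is a number $\lambda_0>1$ with $D_{\lambda_0}[\Gamma]\subseteq\Gamma$ for which there are $C>0$, an integer $s\ge 0$ and $z\in\Gamma$ such that $D_{\lambda_0}^n[B(z,C)]\subseteq V_{\lambda_0}(s+n)$ for all $n\ge 1$. A *substitution on $\mathcal A^{\Gamma}$* is a dilation datum as above together with a finite nonempty alphabet $\mathcal A$, a stretch factor $\lambda_0$ and a substitution rule $S_0:\mathcal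 A\to\mathcal A^{D_{\lambda_0}[V]\cap\Gamma}$. Its substitution map $S$ acts on patches $P:M\to\mathcal A$, $M\subseteq\Gamma$, letter by letter: $S(P)$ has support $\bigsqcup_{\gamma\in M}D_{\lambda_0}(\gamma)\,(D_{\lambda_0}[V]\cap\Gamma)$ and $S(P)(D_{\lambda_0}(\gamma)\kappa)=S_0(P(\gamma))(\kappa)$ for $\gamma\in M$ and $\kappa\in D_{\lambda_0}[V]\cap\Gamma$. A patch $P:M\to\mathcal A$ is a *subpatch* of $Q:K\to\mathcal A$, written $P\prec Q$, if there is $\gamma\in\Gamma$ with $\gamma M\subseteq K$ and $Q(\gamma\eta)=P(\eta)$ for all $\eta\in M$. A letter is identified with a patch supported on $\{e\}$. The substitution is *primitive* if there is $L\ge 1$ with $a\prec S^L(b)$ for all $a,b\in\mathcal A$. Let $\Omega(S)$ be the set of all $\omega\in\mathcal A^{\Gamma}$ such that each finite subpatch $P$ of $\omega$ satisfies $P\prec S^n(a)$ for some $n\ge1$ and $a\in\mathcal A$. The group $\Gamma$ acts on $\mathcal A^\Gamma$ by $(\gamma\omega)(\eta)=\omega(\gamma^{-1}\eta)$, and $\mathcal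 A^\Gamma$ carries the product topology, with $\mathcal A$ discrete. A *subshift* is a nonempty closed invariant subset $\Omega$ of $\mathcal A^\Gamma$. It is *minimal* if every $\omega\in\Omega$ satisfies $\overline{\mathrm{Orb}(\omega)}=\Omega$. It is *strongly aperiodic* if every $\omega\in\Omega$ has trivial stabilizer. It is *periodically approximable* if there are configurations $\omega_n\in\mathcal A^\Gamma$ with finite orbits such that $\delta_H(\mathrm{Orb}(\omega_n),\Omega)\to 0$, where $\delta_H$ is the Hausdorff distance for the metric $\delta(\omega,\rho)=\inf\{\tfrac1{r+1} : r\ge 0,\ \omega(\gamma)=\rho(\gamma) \text{ for all }\gamma\in\Gamma\text{ with } d(\gamma,e)<r\}$. **Statement.** There exist a finite nonempty alphabet $\mathcal A$ and a primitive substitution on $\mathcal A^{\mathbb Z^2}$, with substitution map $S$, such that $\Omega(S)$ is a minimal and strongly aperiodic subshift that is not periodically approximable. -/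

import Mathlib

open Set Filter Topology

/-!
All groups below are written additively, but no commutativity is assumed.
The identity element is `0`, and left translation by `γ` is `η ↦ γ + η`.
-/

namespace SymbolicSubstitution

noncomputable section

/-! ### Dilation data -/

/-- A dilation datum `(G, d, (D_l)_{l > 0}, Γ, V)` whose lattice is the given group `Γ`, regarded
as a subgroup of `G` through the injective homomorphism `incl`. The metric `d` is the metric
`dist` of `G`, and the topology of `G` is the one it induces. -/
structure DilationDatum (Γ : Type) [AddGroup Γ] where
  /-- the ambient group -/
  G : Type
  [addGroup : AddGroup G]
  [metricSpace : MetricSpace G]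
  [topGroup : IsTopologicalAddGroup G]
  /-- `G` is connected and simply connected -/
  [simplyConnected : SimplyConnectedSpace G]
  /-- closed balls are compact -/
  [proper : ProperSpace G]
  /-- `d` is left-invariant -/
  dist_add_left' : ∀ g h k : G, dist (g + h) (g + k) = dist h k
  /-- the one-parameter group of automorphisms -/
  dil : {l : ℝ // 0 < l} → G ≃+ G
  dil_one : ∀ g : G, dil 1 g = g
  dil_mul : ∀ (l m : {l : ℝ // 0 < l}) (g : G), dil (l * m) g = dil l (dil m g)
  continuous_dil : ∀ g : G, Continuous fun l => dil l g
  dist_dil : ∀ (l : {l : ℝ // 0 < l}) (g h : G), dist (dil l g) (dil l h) = l * dist g h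
  /-- the inclusion of the lattice -/
  incl : Γ →+ G
  incl_injective : Function.Injective incl
  discrete : DiscreteTopology incl.range
  cocompact : CompactSpace (G ⧸ incl.range)
  exists_dil_lattice : ∃ l : {l : ℝ // 0 < l}, 1 < (l : ℝ) ∧
    ∀ γ : Γ, dil l (incl γ) ∈ incl.range
  /-- the fundamental domain -/
  V : Set G
  measurable_V : @MeasurableSet G (borel G) V
  relCompact_V : IsCompact (closure V)
  zero_mem_interior_V : (0 : G) ∈ interior V
  /-- `G` is the disjoint union of the sets `γ + V`, `γ ∈ Γ` -/
  fundamental_V : ∀ g : G, ∃! γ : Γ, -incl γ + g ∈ V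

attribute [instance] DilationDatum.addGroup DilationDatum.metricSpace DilationDatum.topGroup
  DilationDatum.simplyConnected DilationDatum.proper

namespace DilationDatum

variable {Γ : Type} [AddGroup Γ] (D : DilationDatum Γ)

/-- The metric `d_Γ`, the restriction of `d` to the lattice. -/
def latticeDist (γ η : Γ) : ℝ := dist (D.incl γ) (D.incl η)

/-- The union `M + V` of the translates `γ + V`, `γ ∈ M`. -/
def tiles (M : Set Γ) : Set D.G := {g | ∃ γ ∈ M, ∃ v ∈ D.V, g = D.incl γ + v}

/-- The sets `V_l(n, M)`: `V_l(0, M) = M + V` and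
`V_l(n + 1, M) = D_l [(V_l(n, M) ∩ Γ) + V]`. -/
def iterSupport (l : {l : ℝ // 0 < l}) (M : Set Γ) : ℕ → Set D.G
  | 0 => D.tiles M
  | n + 1 => D.dil l '' D.tiles (D.incl ⁻¹' iterSupport l M n)

/-- `l` is sufficiently large relative to `V`. -/
def SufficientlyLarge (l : {l : ℝ // 0 < l}) : Prop :=
  ∃ C : ℝ, 0 < C ∧ ∃ (s : ℕ) (z : Γ), ∀ n : ℕ, 1 ≤ n →
    (fun g => (D.dil l)^[n] g) '' Metric.ball (D.incl z) C ⊆ D.iterSupport l {0} (s + n)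

/-- `l` is a stretch factor associated with the dilation datum. -/
structure IsStretchFactor (l : {l : ℝ // 0 < l}) : Prop where
  one_lt : 1 < (l : ℝ)
  maps_lattice : ∀ γ : Γ, D.dil l (D.incl γ) ∈ D.incl.range
  sufficientlyLarge : D.SufficientlyLarge l

/-- The unique `γ ∈ Γ` with `g ∈ γ + V`. -/
def tileOf (g : D.G) : Γ := (D.fundamental_V g).choose

theorem tileOf_spec (g : D.G) : -D.incl (D.tileOf g) + g ∈ D.V :=
  (D.fundamental_V g).choose_spec.1

end DilationDatum

/-! ### Configurations and patches -/

/-- The configuration space `A^Γ`. -/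
def Config (Γ A : Type) : Type := Γ → A

/-- The product topology on `A^Γ`, where `A` is discrete. -/
instance (Γ A : Type) : TopologicalSpace (Config Γ A) :=
  @Pi.topologicalSpace Γ (fun _ => A) fun _ => ⊥

/-- A patch with values in `A`, i.e. a map from a subset `M` of `Γ` to `A`: the value at `γ` is
`some a` if `γ ∈ M` is sent to `a`, and `none` if `γ ∉ M`. -/
def Patch (Γ A : Type) : Type := Γ → Option A

section Patches

variable {Γ A : Type}

/-- The support of a patch. -/
def Patch.support (P : Patch Γ A) : Set Γ := {γ | P γ ≠ none}

/-- A configuration as a patch with support `Γ`. -/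
def Config.toPatch (ω : Config Γ A) : Patch Γ A := fun γ => some (ω γ)

variable [AddGroup Γ]

open Classical in
/-- A letter as a patch with support `{0}`. -/
def Patch.letter (a : A) : Patch Γ A := fun γ => if γ = 0 then some a else none

/-- `P` is a subpatch of `Q` (written `P ≺ Q`): some translate of the support of `P` lies in the
support of `Q` and the values agree. -/
def Patch.IsSubpatch (P Q : Patch Γ A) : Prop :=
  ∃ γ : Γ, ∀ (η : Γ) (a : A), P η = some a → Q (γ + η) = some a

/-- The dictionary `W(ω)`: all finite subpatches of `ω`. -/
def dictionary (ω : Config Γ A) : Set (Patch Γ A) :=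
  {P | P.support.Finite ∧ P.IsSubpatch ω.toPatch}

/-! ### Subshifts -/

/-- The left translation action `(γ ω)(η) = ω(γ⁻¹ η)`. -/
def translate (γ : Γ) (ω : Config Γ A) : Config Γ A := fun η => ω (-γ + η)

/-- The orbit of a configuration. -/
def orbit (ω : Config Γ A) : Set (Config Γ A) := {ρ | ∃ γ : Γ, ρ = translate γ ω}

/-- A configuration is periodic if its orbit is finite. -/
def IsPeriodic (ω : Config Γ A) : Prop := (orbit ω).Finite

/-- A subshift is a nonempty, closed and invariant set of configurations. -/
structure IsSubshift (Ω : Set (Config Γ A)) : Prop where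
  nonempty : Ω.Nonempty
  closed : IsClosed Ω
  invariant : ∀ γ : Γ, ∀ ω ∈ Ω, translate γ ω ∈ Ω

/-- Every orbit is dense. -/
def IsMinimalSubshift (Ω : Set (Config Γ A)) : Prop :=
  IsSubshift Ω ∧ ∀ ω ∈ Ω, closure (orbit ω) = Ω

/-- All stabilizers are trivial. -/
def IsStronglyAperiodic (Ω : Set (Config Γ A)) : Prop :=
  ∀ ω ∈ Ω, {γ : Γ | translate γ ω = ω} = {0}

/-- The metric on configurations: the infimum of `1 / (r + 1)` over all `r ≥ 0` such that
`ω` and `ρ` agree on the open ball of radius `r` around the identity for the metric `d` on `Γ`. -/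
def configDist (d : Γ → Γ → ℝ) (ω ρ : Config Γ A) : ℝ :=
  sInf {t | ∃ r : ℝ, 0 ≤ r ∧ (∀ γ : Γ, d γ 0 < r → ω γ = ρ γ) ∧ t = 1 / (r + 1)}

/-- The Hausdorff distance `δ_H` on sets of configurations. All distances lie in `[0, 1]`, so that
for nonempty sets all infima and suprema are genuine. -/
def configHausdorffDist (d : Γ → Γ → ℝ) (Ω₁ Ω₂ : Set (Config Γ A)) : ℝ :=
  max (⨆ ω : Ω₁, ⨅ ρ : Ω₂, configDist d ω.1 ρ.1) (⨆ ρ : Ω₂, ⨅ ω : Ω₁, configDist d ρ.1 ω.1)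

/-- `Ω` is the limit, in the Hausdorff metric, of finite orbits of periodic configurations. -/
def IsPeriodicallyApproximable (d : Γ → Γ → ℝ) (Ω : Set (Config Γ A)) : Prop :=
  ∃ ω : ℕ → Config Γ A, (∀ n, IsPeriodic (ω n)) ∧
    Tendsto (fun n => configHausdorffDist d (orbit (ω n)) Ω) atTop (𝓝 0)

end Patches

/-! ### Substitutions -/

/-- A substitution on `A^Γ`: a dilation datum with lattice `Γ`, a stretch factor and a
substitution rule `S₀ : A → A^(D_l[V] ∩ Γ)`. The alphabet is finite and nonempty. -/
structure Substitution (Γ A : Type) [AddGroup Γ] extends DilationDatum Γ where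
  finite_alphabet : Finite A
  nonempty_alphabet : Nonempty A
  /-- the stretch factor -/
  stretch : {l : ℝ // 0 < l}
  isStretch : toDilationDatum.IsStretchFactor stretch
  /-- the substitution rule -/
  rule : A → {κ : Γ // incl κ ∈ dil stretch '' V} → A

namespace Substitution

variable {Γ A : Type} [AddGroup Γ] (σ : Substitution Γ A)

/-- The restriction of the dilation by the stretch factor to the lattice. -/
def latticeDil (γ : Γ) : Γ := (σ.isStretch.maps_lattice γ).choose

theorem incl_latticeDil (γ : Γ) : σ.incl (σ.latticeDil γ) = σ.dil σ.stretch (σ.incl γ) :=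
  (σ.isStretch.maps_lattice γ).choose_spec

/-- The unique `γ ∈ Γ` such that `η ∈ D(γ) + D[V]`, where `D` is the dilation by the
stretch factor. -/
def parent (η : Γ) : Γ := σ.tileOf ((σ.dil σ.stretch).symm (σ.incl η))

/-- The position `κ = -D(γ) + η ∈ D[V] ∩ Γ` of `η` in the block `D(γ) + D[V]` that contains it. -/
def position (η : Γ) : {κ : Γ // σ.incl κ ∈ σ.dil σ.stretch '' σ.V} :=
  ⟨-σ.latticeDil (σ.parent η) + η,
    ⟨-σ.incl (σ.parent η) + (σ.dil σ.stretch).symm (σ.incl η), σ.tileOf_spec _, by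
      rw [map_add, map_neg, map_add, map_neg, incl_latticeDil, AddEquiv.apply_symm_apply]⟩⟩

/-- The substitution map `S` on patches. It acts letter by letter: if `γ` is in the support of `P`
and `κ ∈ D[V] ∩ Γ`, then `S(P)(D(γ) + κ) = S₀(P(γ))(κ)`, and the support of `S(P)` consists of these
points `D(γ) + κ`. -/
def map (P : Patch Γ A) : Patch Γ A := fun η =>
  (P (σ.parent η)).map fun a => σ.rule a (σ.position η)

/-- A letter `a` occurs in `S^L(b)` for all letters `a`, `b`, with a common `L ≥ 1`. -/
def IsPrimitive : Prop :=
  ∃ L : ℕ, 1 ≤ L ∧ ∀ a b : A, (Patch.letter a).IsSubpatch (σ.map^[L] (Patch.letter b))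

/-- The set `W(S)` of legal patches: the finite patches `P ≺ S^n(a)`, where `n ≥ 1` and `a` is a
letter. -/
def legalPatches : Set (Patch Γ A) :=
  {P | P.support.Finite ∧ ∃ n : ℕ, 1 ≤ n ∧ ∃ a : A, P.IsSubpatch (σ.map^[n] (Patch.letter a))}

/-- The set `Ω(S)` of all configurations whose finite subpatches are legal. -/
def subshift : Set (Config Γ A) := {ω | dictionary ω ⊆ σ.legalPatches}

end Substitution

end

end SymbolicSubstitution

/-! The subshift Ω(S) lies in a nearest-neighbour shift of finite type, the set of `Admissible`
configurations, none of which has a nonzero period. This gives strong aperiodicity. It also excludes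
periodic approximation: if an orbit is Hausdorff close to Ω(S), all its pairs of neighbours are
admissible, so its configuration is admissible and the orbit is infinite.

Periods are excluded by descent (`Admissible.period_eq_zero`). Each letter records the parities of
its place, and these alternate, so periods are even. The letters with parities (0, 0) again form an
admissible configuration, with half the period (`exists_desubstitution`). Their new parities are
read off the cross at the upper right; the colours carry these along lines to the adjacent blocks,
which forces them to alternate. The new parities must also fit the tile: `Legal` records the trace
that this leaves on the right and upper edges, and `fits_of_neighbours` recovers the fit from it.

The substitution runs this backwards and preserves adjacency, so Ω(S) consists of admissible
configurations. It is nonempty because some cross reappears in the interior of its own image under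
S², and minimal because S is primitive and every large window contains a full block. -/

namespace SymbolicSubstitution

/-! ### Tiles -/

/-- A colour of an edge: the first entry is `true` if the edge points upwards or to the right,
the other two are the parities of the line segment that the edge belongs to. -/
abbrev Color : Type := Bool × Bool × Bool

/-- The tiles: a cross, from which four lines emanate, or a vertical (horizontal) line that
is met from both sides by the ends of two horizontal (vertical) lines. -/
inductive Tile : Type
  | cross (a c : Bool) : Tile
  | vert (v : Color) (a c : Bool) : Tile
  | horiz (h : Color) (a c : Bool) : Tile

namespace Tile

/-- The colour of the upper edge. -/
def north : Tile → Color
  | cross a c => (true, a, c)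
  | vert v _ _ => v
  | horiz _ a c => (false, a, c)

/-- The colour of the lower edge. -/
def south : Tile → Color
  | cross a c => (false, a, c)
  | vert v _ _ => v
  | horiz _ a c => (true, a, !c)

/-- The colour of the right edge. -/
def east : Tile → Color
  | cross a c => (true, a, c)
  | vert _ a c => (false, a, c)
  | horiz h _ _ => h

/-- The colour of the left edge. -/
def west : Tile → Color
  | cross a c => (false, a, c)
  | vert _ a c => (true, !a, c)
  | horiz h _ _ => h

/-- The condition on a tile that forces the hierarchy of crosses. -/
def Legal : Tile → Prop
  | cross _ _ => True
  | vert v a c => a = true → v.1 = c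
  | horiz h a c => c = true → h.1 = a

/-- The tiles that may be placed at points whose coordinates have the given parities. -/
def Fits (px py : Bool) : Tile → Prop
  | cross _ _ => px = py
  | vert _ _ _ => px = false
  | horiz _ _ _ => py = false

@[simp] theorem north_cross (a c : Bool) : (cross a c).north = (true, a, c) := rfl
@[simp] theorem north_vert (v : Color) (a c : Bool) : (vert v a c).north = v := rfl
@[simp] theorem north_horiz (h : Color) (a c : Bool) : (horiz h a c).north = (false, a, c) := rfl
@[simp] theorem south_cross (a c : Bool) : (cross a c).south = (false, a, c) := rfl
@[simp] theorem south_vert (v : Color) (a c : Bool) : (vert v a c).south = v := rfl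
@[simp] theorem south_horiz (h : Color) (a c : Bool) : (horiz h a c).south = (true, a, !c) := rfl
@[simp] theorem east_cross (a c : Bool) : (cross a c).east = (true, a, c) := rfl
@[simp] theorem east_vert (v : Color) (a c : Bool) : (vert v a c).east = (false, a, c) := rfl
@[simp] theorem east_horiz (h : Color) (a c : Bool) : (horiz h a c).east = h := rfl
@[simp] theorem west_cross (a c : Bool) : (cross a c).west = (false, a, c) := rfl
@[simp] theorem west_vert (v : Color) (a c : Bool) : (vert v a c).west = (true, !a, c) := rfl
@[simp] theorem west_horiz (h : Color) (a c : Bool) : (horiz h a c).west = h := rfl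

@[simp] theorem legal_vert (v : Color) (a c : Bool) : (vert v a c).Legal ↔ (a = true → v.1 = c) :=
  Iff.rfl

@[simp] theorem legal_horiz (h : Color) (a c : Bool) :
    (horiz h a c).Legal ↔ (c = true → h.1 = a) := Iff.rfl

@[simp] theorem fits_cross (px py a c : Bool) : (cross a c).Fits px py ↔ px = py := Iff.rfl

@[simp] theorem fits_vert (px py : Bool) (v : Color) (a c : Bool) :
    (vert v a c).Fits px py ↔ px = false := Iff.rfl

@[simp] theorem fits_horiz (px py : Bool) (h : Color) (a c : Bool) :
    (horiz h a c).Fits px py ↔ py = false := Iff.rfl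

instance : Finite Tile := by
  refine Finite.of_surjective
    (fun s : (Bool × Bool) ⊕ (Color × Bool × Bool) ⊕ (Color × Bool × Bool) =>
      match s with
      | .inl (a, c) => cross a c
      | .inr (.inl (v, a, c)) => vert v a c
      | .inr (.inr (h, a, c)) => horiz h a c) ?_
  rintro (⟨a, c⟩ | ⟨v, a, c⟩ | ⟨h, a, c⟩)
  · exact ⟨.inl (a, c), rfl⟩
  · exact ⟨.inr (.inl (v, a, c)), rfl⟩
  · exact ⟨.inr (.inr (h, a, c)), rfl⟩

end Tile

/-- The letters: tiles together with the parities of the coordinates of their place. -/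
@[ext]
structure Letter : Type where
  px : Bool
  py : Bool
  tile : Tile
  legal : tile.Legal
  fits : tile.Fits px py

namespace Letter

open Tile

instance : Finite Letter := by
  refine Finite.of_injective (fun t : Letter => (t.px, t.py, t.tile)) ?_
  intro s t h
  simp only [Prod.mk.injEq] at h
  exact Letter.ext h.1 h.2.1 h.2.2

/-- `r` may be the right neighbour of `l`. -/
def HAdj (l r : Letter) : Prop :=
  r.px = !l.px ∧ r.py = l.py ∧ l.tile.east = r.tile.west

/-- `u` may be the upper neighbour of `d`. -/
def VAdj (d u : Letter) : Prop :=
  u.py = !d.py ∧ u.px = d.px ∧ d.tile.north = u.tile.south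

/-- The substitution rule: the tile `t` is placed in the lower left corner of a `2 × 2` block and
its lines are prolonged, and there is a cross with the parities of `t` in the upper right corner. -/
def sub (t : Letter) : Bool → Bool → Letter
  | false, false => ⟨false, false, t.tile, t.legal, by cases t.tile <;> rfl⟩
  | true, true => ⟨true, true, cross t.px t.py, trivial, rfl⟩
  -- Legality: if the second parity of `t` is odd, `t` is an odd cross, whose right edge points
  -- right, or a vertical line with even first parity, whose right edge points left. The vertical
  -- case below is symmetric.
  | true, false => ⟨true, false, horiz t.tile.east t.px t.py, by
      obtain ⟨px, py, _ | _ | _, h, k⟩ := t <;> dsimp only <;> simp_all, rfl⟩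
  | false, true => ⟨false, true, vert t.tile.north t.px t.py, by
      obtain ⟨px, py, _ | _ | _, h, k⟩ := t <;> dsimp only <;> simp_all, rfl⟩

theorem hAdj_sub (t : Letter) (j : Bool) : HAdj (t.sub false j) (t.sub true j) := by
  cases j <;> simp [HAdj, sub]

theorem vAdj_sub (t : Letter) (i : Bool) : VAdj (t.sub i false) (t.sub i true) := by
  cases i <;> simp [VAdj, sub]

/-- In the lower row the edge between `l` and `r` reappears. In the upper row the cross sends the
parities of `l` to the right, and the vertical line of `r` expects those of `r` with the first one
flipped; they agree because parities alternate. -/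
theorem HAdj.sub {l r : Letter} (h : HAdj l r) (j : Bool) :
    HAdj (l.sub true j) (r.sub false j) := by
  obtain ⟨h₁, h₂, h₃⟩ := h
  cases j <;> simp [HAdj, Letter.sub, h₁, h₂, h₃]

theorem VAdj.sub {d u : Letter} (h : VAdj d u) (i : Bool) :
    VAdj (d.sub i true) (u.sub i false) := by
  obtain ⟨h₁, h₂, h₃⟩ := h
  cases i <;> simp [VAdj, Letter.sub, h₁, h₂, h₃]

end Letter

/-! ### Admissible configurations have no periods -/

open Letter Tile

/-- A configuration of letters is admissible if all neighbours fit together. -/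
def Admissible (ω : Config (ℤ × ℤ) Letter) : Prop :=
  (∀ x y, HAdj (ω (x, y)) (ω (x + 1, y))) ∧ ∀ x y, VAdj (ω (x, y)) (ω (x, y + 1))

theorem bool_alternating {f : ℤ → Bool} (h : ∀ x, f (x + 1) = !f x) (x : ℤ) :
    f x = (f 0 ^^ decide (x % 2 = 1)) := by
  induction x using Int.induction_on with
  | zero => simp
  | succ n ih =>
    rw [h, ih]
    rcases Int.emod_two_eq_zero_or_one n with e | e <;>
      simp [e, show ((n : ℤ) + 1) % 2 = 1 - (n : ℤ) % 2 by omega]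
  | pred n ih =>
    have h' := h (-n - 1)
    rw [sub_add_cancel] at h'
    rw [ih] at h'
    rcases Int.emod_two_eq_zero_or_one (-n : ℤ) with e | e <;>
      simp_all [show (-(n : ℤ) - 1) % 2 = 1 - (-n : ℤ) % 2 by omega]

namespace Admissible

variable {ω : Config (ℤ × ℤ) Letter}

theorem px_eq (hω : Admissible ω) (x y : ℤ) :
    (ω (x, y)).px = ((ω (0, 0)).px ^^ decide (x % 2 = 1)) := by
  rw [bool_alternating (f := fun x => (ω (x, y)).px) (fun x => (hω.1 x y).1) x]
  congr 1
  induction y using Int.induction_on with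
  | zero => rfl
  | succ n ih => exact (hω.2 0 n).2.1.trans ih
  | pred n ih =>
    have := (hω.2 0 (-n - 1)).2.1
    rw [sub_add_cancel] at this
    exact this.symm.trans ih

theorem py_eq (hω : Admissible ω) (x y : ℤ) :
    (ω (x, y)).py = ((ω (0, 0)).py ^^ decide (y % 2 = 1)) := by
  rw [bool_alternating (f := fun y => (ω (x, y)).py) (fun y => (hω.2 x y).1) y]
  congr 1
  induction x using Int.induction_on with
  | zero => rfl
  | succ n ih => exact (hω.1 n 0).2.1.trans ih
  | pred n ih =>
    have := (hω.1 (-n - 1) 0).2.1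
    rw [sub_add_cancel] at this
    exact this.symm.trans ih

theorem shift (hω : Admissible ω) (a b : ℤ) :
    Admissible fun η : ℤ × ℤ => ω (a + η.1, b + η.2) := by
  refine ⟨fun x y => ?_, fun x y => ?_⟩
  · simpa only [add_assoc] using hω.1 (a + x) (b + y)
  · simpa only [add_assoc] using hω.2 (a + x) (b + y)

end Admissible

/-- If a letter `s` with parities `(0, 0)` is the lower left corner of an admissible `2 × 2` block,
then the upper right corner is a cross, and the other two are determined by its parities. -/
theorem exists_block {s r u c : Letter} (hs : s.px = false ∧ s.py = false)
    (hr : HAdj s r) (hu : VAdj s u) (hc : HAdj u c) (hc' : VAdj r c) :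
    ∃ a b, c.tile = cross a b ∧ r.tile = horiz s.tile.east a b ∧
      u.tile = vert s.tile.north a b := by
  obtain ⟨sx, sy, s, ls, fs⟩ := s
  obtain ⟨rx, ry, r, lr, fr⟩ := r
  obtain ⟨ux, uy, u, lu, fu⟩ := u
  obtain ⟨cx, cy, c, lc, fc⟩ := c
  dsimp only [HAdj, VAdj] at hs hr hu hc hc' ⊢
  cases r <;> cases u <;> cases c <;>
    simp_all

/-- A tile `s` fits the parities `a`, `b` if it, its left neighbour `l` and its lower neighbour `d`
satisfy the conditions that legal tiles between them impose. -/
theorem fits_of_neighbours {s l d : Tile} {a b : Bool}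
    (hs : b = true → s.east.1 = a) (hs' : a = true → s.north.1 = b)
    (hl : b = true → l.east.1 = !a) (hl' : (!a) = true → l.north.1 = b)
    (hd : (!b) = true → d.east.1 = a) (hd' : a = true → d.north.1 = !b)
    (h : l.east = s.west) (v : d.north = s.south) : s.Fits a b := by
  cases a <;> cases b <;> cases s <;> cases l <;> cases d <;> simp_all

namespace Admissible

variable {ω : Config (ℤ × ℤ) Letter}

/-- Admissible configurations can be desubstituted: the letters with parities `(0, 0)` form an
admissible configuration after a change of their parities. -/
theorem exists_desubstitution (hω : Admissible ω)
    (h₀ : (ω (0, 0)).px = false ∧ (ω (0, 0)).py = false) :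
    ∃ ρ : Config (ℤ × ℤ) Letter, Admissible ρ ∧
      ∀ a b : ℤ, (∀ x y, ω (2 * a + x, 2 * b + y) = ω (x, y)) →
        ∀ x y, ρ (a + x, b + y) = ρ (x, y) := by
  have hpar (x y : ℤ) : (ω (2 * x, 2 * y)).px = false ∧ (ω (2 * x, 2 * y)).py = false := by
    rw [hω.px_eq, hω.py_eq, h₀.1, h₀.2]
    simp
  have hblock (x y : ℤ) := exists_block (hpar x y) (hω.1 _ _) (hω.2 _ _) (hω.1 _ _) (hω.2 _ _)
  choose a b hc hr hu using hblock
  have heast (x y : ℤ) : (ω (2 * x, 2 * y)).tile.east = (ω (2 * (x + 1), 2 * y)).tile.west := by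
    have := (hω.1 (2 * x + 1) (2 * y)).2.2
    rw [hr, show 2 * x + 1 + 1 = 2 * (x + 1) by ring] at this
    exact this
  have hnorth (x y : ℤ) :
      (ω (2 * x, 2 * y)).tile.north = (ω (2 * x, 2 * (y + 1))).tile.south := by
    have := (hω.2 (2 * x) (2 * y + 1)).2.2
    rw [hu, show 2 * y + 1 + 1 = 2 * (y + 1) by ring] at this
    exact this
  -- The line from a cross to the right ends at the vertical line of the next block, whose left
  -- colour has the first parity negated.
  have ha (x y : ℤ) : a (x + 1) y = !a x y ∧ b (x + 1) y = b x y := by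
    have := (hω.1 (2 * x + 1) (2 * y + 1)).2.2
    rw [hc, show 2 * x + 1 + 1 = 2 * (x + 1) by ring, hu] at this
    simp_all
  have hb (x y : ℤ) : b x (y + 1) = !b x y ∧ a x (y + 1) = a x y := by
    have := (hω.2 (2 * x + 1) (2 * y + 1)).2.2
    rw [hc, show 2 * y + 1 + 1 = 2 * (y + 1) by ring, hr] at this
    simp_all
  have he (x y : ℤ) : b x y = true → (ω (2 * x, 2 * y)).tile.east.1 = a x y := by
    have := (ω (2 * x + 1, 2 * y)).legal
    rwa [hr] at this
  have hn (x y : ℤ) : a x y = true → (ω (2 * x, 2 * y)).tile.north.1 = b x y := by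
    have := (ω (2 * x, 2 * y + 1)).legal
    rwa [hu] at this
  have hfits (x y : ℤ) : (ω (2 * x, 2 * y)).tile.Fits (a x y) (b x y) := by
    have hl := ha (x - 1) y
    have hd := hb x (y - 1)
    have h₁ := heast (x - 1) y
    have h₂ := hnorth x (y - 1)
    rw [sub_add_cancel] at hl hd h₁ h₂
    have ea : a (x - 1) y = !a x y := by rw [hl.1, Bool.not_not]
    have eb : b x (y - 1) = !b x y := by rw [hd.1, Bool.not_not]
    refine fits_of_neighbours (he x y) (hn x y) ?_ ?_ ?_ ?_ h₁ h₂
    · simpa only [ea, ← hl.2] using he (x - 1) y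
    · simpa only [ea, ← hl.2] using hn (x - 1) y
    · simpa only [eb, ← hd.2] using he x (y - 1)
    · simpa only [eb, ← hd.2] using hn x (y - 1)
  refine ⟨fun η => ⟨a η.1 η.2, b η.1 η.2, (ω (2 * η.1, 2 * η.2)).tile,
    (ω (2 * η.1, 2 * η.2)).legal, hfits _ _⟩,
    ⟨fun x y => ⟨(ha x y).1, (ha x y).2, heast x y⟩,
      fun x y => ⟨(hb x y).1, (hb x y).2, hnorth x y⟩⟩, fun u v huv x y => ?_⟩
  -- The new parities are entries of a cross of `ω` at an odd point, so they inherit the period too.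
  have h₁ := hc (u + x) (v + y)
  rw [show 2 * (u + x) + 1 = 2 * u + (2 * x + 1) by ring,
    show 2 * (v + y) + 1 = 2 * v + (2 * y + 1) by ring, huv, hc] at h₁
  have h₂ := huv (2 * x) (2 * y)
  rw [← mul_add, ← mul_add] at h₂
  obtain ⟨e₁, e₂⟩ := cross.inj h₁
  exact Letter.ext e₁.symm e₂.symm (congrArg Letter.tile h₂ :)

/-- An admissible configuration has no nonzero period. -/
theorem period_eq_zero (hω : Admissible ω) {u v : ℤ}
    (h : ∀ x y, ω (u + x, v + y) = ω (x, y)) : u = 0 ∧ v = 0 := by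
  induction hn : u.natAbs + v.natAbs using Nat.strong_induction_on generalizing ω u v with
  | _ n ih =>
  have hu : u % 2 = 0 := by
    have := congrArg Letter.px (h 0 0)
    rw [add_zero, add_zero, hω.px_eq] at this
    rcases Int.emod_two_eq_zero_or_one u with e | e
    · exact e
    · simp [e] at this
  have hv : v % 2 = 0 := by
    have := congrArg Letter.py (h 0 0)
    rw [add_zero, add_zero, hω.py_eq] at this
    rcases Int.emod_two_eq_zero_or_one v with e | e
    · exact e
    · simp [e] at this
  -- A translation moves the letters with parities (0, 0) to the even points and keeps the period.
  obtain ⟨i, j, hij⟩ : ∃ i j : ℤ, (ω (i, j)).px = false ∧ (ω (i, j)).py = false := by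
    refine ⟨if (ω (0, 0)).px then 1 else 0, if (ω (0, 0)).py then 1 else 0, ?_⟩
    rw [hω.px_eq, hω.py_eq]
    cases (ω (0, 0)).px <;> cases (ω (0, 0)).py <;> simp
  obtain ⟨ρ, hρ, hper⟩ := (hω.shift i j).exists_desubstitution (by simpa using hij)
  have hper' := hper (u / 2) (v / 2) fun x y => by
    rw [Int.mul_ediv_cancel' (Int.dvd_of_emod_eq_zero hu),
      Int.mul_ediv_cancel' (Int.dvd_of_emod_eq_zero hv)]
    simpa only [add_left_comm] using h (i + x) (j + y)
  by_cases h0 : u = 0 ∧ v = 0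
  · exact h0
  · have := ih ((u / 2).natAbs + (v / 2).natAbs) (by omega) hρ hper' rfl
    omega

end Admissible

noncomputable section

/-! ### The substitution -/

/-- The homotheties of the plane, as automorphisms. -/
def planeDil (l : {l : ℝ // 0 < l}) : ℝ × ℝ ≃+ ℝ × ℝ where
  toFun g := (l : ℝ) • g
  invFun g := (l : ℝ)⁻¹ • g
  left_inv g := inv_smul_smul₀ l.2.ne' g
  right_inv g := smul_inv_smul₀ l.2.ne' g
  map_add' := smul_add _

/-- The stretch factor `2`. -/
def two : {l : ℝ // 0 < l} := ⟨2, two_pos⟩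

/-- The inclusion of the integer lattice in the plane. -/
def latticeIncl : ℤ × ℤ →+ ℝ × ℝ :=
  (Int.castAddHom ℝ).prodMap (Int.castAddHom ℝ)

theorem latticeIncl_apply (γ : ℤ × ℤ) : latticeIncl γ = ((γ.1 : ℝ), (γ.2 : ℝ)) := rfl

theorem latticeIncl_two_nsmul (γ : ℤ × ℤ) :
    latticeIncl (2 • γ) = planeDil two (latticeIncl γ) := by
  rw [map_nsmul]
  exact (ofNat_smul_eq_nsmul ℝ 2 _).symm

/-- The fundamental domain `[-1/4, 3/4)²`. -/
def shiftedSquare : Set (ℝ × ℝ) := Ico (-1 / 4) (3 / 4) ×ˢ Ico (-1 / 4) (3 / 4)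

theorem mem_shiftedSquare {g : ℝ × ℝ} : g ∈ shiftedSquare ↔
    (-1 / 4 ≤ g.1 ∧ g.1 < 3 / 4) ∧ (-1 / 4 ≤ g.2 ∧ g.2 < 3 / 4) := Iff.rfl

theorem neg_latticeIncl_add_mem_iff (γ : ℤ × ℤ) (g : ℝ × ℝ) :
    -latticeIncl γ + g ∈ shiftedSquare ↔ γ = (⌊g.1 + 1 / 4⌋, ⌊g.2 + 1 / 4⌋) := by
  rw [mem_shiftedSquare, Prod.ext_iff, eq_comm (a := γ.1), eq_comm (a := γ.2)]
  simp only [Int.floor_eq_iff, latticeIncl_apply, Prod.fst_add, Prod.snd_add, Prod.fst_neg,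
    Prod.snd_neg]
  constructor <;> rintro ⟨⟨_, _⟩, _, _⟩ <;> refine ⟨⟨?_, ?_⟩, ?_, ?_⟩ <;> linarith

theorem isCompact_closure_shiftedSquare : IsCompact (closure shiftedSquare) := by
  refine (isCompact_Icc.prod isCompact_Icc :
    IsCompact (Icc (-1 / 4 : ℝ) (3 / 4) ×ˢ Icc (-1 / 4 : ℝ) (3 / 4))).closure_of_subset ?_
  exact prod_mono Ico_subset_Icc_self Ico_subset_Icc_self

instance : DiscreteTopology latticeIncl.range := by
  refine discreteTopology_of_isOpen_singleton_zero ?_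
  rw [Metric.isOpen_singleton_iff]
  refine ⟨1, one_pos, ?_⟩
  rintro ⟨_, γ, rfl⟩ h
  have h' : dist (latticeIncl γ) 0 < 1 := h
  rw [latticeIncl_apply, Prod.dist_eq, max_lt_iff] at h'
  simp only [Prod.fst_zero, Prod.snd_zero, dist_zero_right, Real.norm_eq_abs] at h'
  have h₁ : γ.1 = 0 := by rw [← Int.abs_lt_one_iff]; exact_mod_cast h'.1
  have h₂ : γ.2 = 0 := by rw [← Int.abs_lt_one_iff]; exact_mod_cast h'.2
  ext1
  simp [latticeIncl_apply, h₁, h₂]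

instance : CompactSpace ((ℝ × ℝ) ⧸ latticeIncl.range) := by
  refine ⟨?_⟩
  have h : (QuotientAddGroup.mk : ℝ × ℝ → (ℝ × ℝ) ⧸ latticeIncl.range) ''
      closure shiftedSquare = univ := by
    refine eq_univ_of_forall fun q => ?_
    obtain ⟨g, rfl⟩ := QuotientAddGroup.mk_surjective q
    refine ⟨_, subset_closure ((neg_latticeIncl_add_mem_iff _ g).2 rfl), ?_⟩
    rw [QuotientAddGroup.eq]
    refine ⟨(⌊g.1 + 1 / 4⌋, ⌊g.2 + 1 / 4⌋), ?_⟩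
    abel
  rw [← h]
  exact isCompact_closure_shiftedSquare.image continuous_quotient_mk'

/-- The plane with its lattice of integer points, as a dilation datum. -/
def planeDatum : DilationDatum (ℤ × ℤ) where
  G := ℝ × ℝ
  dist_add_left' g h k := dist_add_left g h k
  dil := planeDil
  dil_one g := one_smul ℝ g
  dil_mul l m g := mul_smul (l : ℝ) (m : ℝ) g
  continuous_dil g := continuous_subtype_val.smul continuous_const
  dist_dil l g h := by
    refine (dist_smul₀ (l : ℝ) g h).trans ?_
    rw [Real.norm_of_nonneg l.2.le]
  incl := latticeIncl
  incl_injective γ η h := by simpa [latticeIncl_apply, Prod.ext_iff] using h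
  discrete := inferInstance
  cocompact := inferInstance
  exists_dil_lattice := by
    exact ⟨two, one_lt_two, fun γ => ⟨2 • γ, latticeIncl_two_nsmul γ⟩⟩
  V := shiftedSquare
  measurable_V := by
    rw [← BorelSpace.measurable_eq (α := ℝ × ℝ)]
    exact measurableSet_Ico.prod measurableSet_Ico
  relCompact_V := isCompact_closure_shiftedSquare
  zero_mem_interior_V := by
    -- The square [0, 1)² would have 0 on its boundary. The shift by 1/4 is so small that the
    -- doubled square still has lattice points {0, 1}².
    rw [shiftedSquare, interior_prod_eq, interior_Ico]
    constructor <;> constructor <;> norm_num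
  fundamental_V g := by
    simp only [neg_latticeIncl_add_mem_iff]
    exact existsUnique_eq

theorem planeDatum_tileOf (g : ℝ × ℝ) :
    planeDatum.tileOf g = (⌊g.1 + 1 / 4⌋, ⌊g.2 + 1 / 4⌋) :=
  (neg_latticeIncl_add_mem_iff _ g).1 (planeDatum.tileOf_spec g)

/-- The tile that contains half of `g` is indexed by coordinates ⌊t / 2 + 1 / 4⌋, which lie in {0,
…, 2 ^ n - 1}. The bounds are chosen to hold for `n = 0` as well. -/
theorem mem_iterSupport_two (n : ℕ) (g : ℝ × ℝ) (h₁ : -1 / 4 ≤ g.1 ∧ g.1 < 2 ^ n - 1 / 2)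
    (h₂ : -1 / 4 ≤ g.2 ∧ g.2 < 2 ^ n - 1 / 2) : g ∈ planeDatum.iterSupport two {0} n := by
  induction n generalizing g with
  | zero =>
    refine ⟨0, rfl, g, ⟨⟨h₁.1, ?_⟩, h₂.1, ?_⟩, ?_⟩
    · linarith [h₁.2]
    · linarith [h₂.2]
    · exact ((congrArg (· + g) (map_zero latticeIncl)).trans (zero_add g)).symm
  | succ n ih =>
    have key (t : ℝ) (ht : -1 / 4 ≤ t ∧ t < 2 ^ (n + 1) - 1 / 2) :
        -1 / 4 ≤ (⌊t / 2 + 1 / 4⌋ : ℝ) ∧ (⌊t / 2 + 1 / 4⌋ : ℝ) < 2 ^ n - 1 / 2 := by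
      have h0 : 0 ≤ ⌊t / 2 + 1 / 4⌋ := Int.floor_nonneg.2 (by linarith [ht.1])
      have h1 : ⌊t / 2 + 1 / 4⌋ < (2 : ℤ) ^ n := Int.floor_lt.2 (by
        push_cast
        rw [pow_succ] at ht
        linarith [ht.2])
      have h0' : (0 : ℝ) ≤ ⌊t / 2 + 1 / 4⌋ := by exact_mod_cast h0
      have h1' : (⌊t / 2 + 1 / 4⌋ : ℝ) ≤ 2 ^ n - 1 := by
        have : ⌊t / 2 + 1 / 4⌋ ≤ (2 : ℤ) ^ n - 1 := by omega
        exact_mod_cast this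
      constructor <;> linarith
    refine ⟨(g.1 / 2, g.2 / 2), ⟨(⌊g.1 / 2 + 1 / 4⌋, ⌊g.2 / 2 + 1 / 4⌋),
      ih _ (key _ h₁) (key _ h₂), _, (neg_latticeIncl_add_mem_iff _ (g.1 / 2, g.2 / 2)).2 rfl,
      (add_neg_cancel_left _ _).symm⟩, ?_⟩
    exact Prod.ext (mul_div_cancel₀ g.1 two_ne_zero) (mul_div_cancel₀ g.2 two_ne_zero)

theorem iterate_planeDil_two (n : ℕ) (g : ℝ × ℝ) :
    (planeDil two)^[n] g = ((2 : ℝ) ^ n * g.1, (2 : ℝ) ^ n * g.2) := by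
  induction n with
  | zero => simp
  | succ n ih =>
    rw [Function.iterate_succ_apply', ih]
    ext1
    · exact (mul_assoc 2 _ _).symm.trans (by rw [pow_succ'])
    · exact (mul_assoc 2 _ _).symm.trans (by rw [pow_succ'])

theorem isStretchFactor_two : planeDatum.IsStretchFactor two where
  one_lt := one_lt_two
  maps_lattice γ := ⟨2 • γ, latticeIncl_two_nsmul γ⟩
  sufficientlyLarge := by
    -- In the maximum metric this ball is (1/2, 3/2)², and 2 ^ n * 3 / 2 = 2 ^ (n + 1) - 2 ^ n / 2 ≤
    -- 2 ^ (n + 1) - 1 / 2.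
    refine ⟨1 / 2, by norm_num, 1, (1, 1), fun n _ => ?_⟩
    rintro _ ⟨(g : ℝ × ℝ), hg, rfl⟩
    have hg' : dist g (latticeIncl (1, 1)) < 1 / 2 := hg
    rw [Prod.dist_eq, max_lt_iff, latticeIncl_apply] at hg'
    simp only [Int.cast_one, Real.dist_eq, abs_lt] at hg'
    have key (t : ℝ) (ht : -(1 / 2) < t - 1 ∧ t - 1 < 1 / 2) :
        -1 / 4 ≤ 2 ^ n * t ∧ 2 ^ n * t < 2 ^ (1 + n) - 1 / 2 := by
      have h : (1 : ℝ) ≤ 2 ^ n := one_le_pow₀ one_le_two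
      rw [pow_add, pow_one]
      constructor <;> nlinarith
    change (planeDil two)^[n] g ∈ _
    rw [iterate_planeDil_two]
    exact mem_iterSupport_two _ _ (key _ hg'.1) (key _ hg'.2)

/-- The substitution on the 104 letters. -/
def crossSubstitution : Substitution (ℤ × ℤ) Letter where
  toDilationDatum := planeDatum
  finite_alphabet := inferInstance
  nonempty_alphabet := ⟨⟨true, true, .cross true true, trivial, rfl⟩⟩
  stretch := two
  isStretch := isStretchFactor_two
  rule t κ := t.sub (decide (κ.1.1 % 2 = 1)) (decide (κ.1.2 % 2 = 1))

theorem crossSubstitution_latticeDil (γ : ℤ × ℤ) : crossSubstitution.latticeDil γ = 2 • γ := by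
  exact planeDatum.incl_injective
    ((crossSubstitution.incl_latticeDil γ).trans (latticeIncl_two_nsmul γ).symm)

theorem crossSubstitution_parent (η : ℤ × ℤ) :
    crossSubstitution.parent η = (η.1 / 2, η.2 / 2) := by
  have key (t : ℤ) : ⌊(2 : ℝ)⁻¹ * t + 1 / 4⌋ = t / 2 := by
    have h : (t : ℝ) = 2 * ((t / 2 : ℤ) : ℝ) + ((t % 2 : ℤ) : ℝ) := by
      exact_mod_cast (Int.mul_ediv_add_emod t 2).symm
    have h' : (0 : ℝ) ≤ ((t % 2 : ℤ) : ℝ) ∧ ((t % 2 : ℤ) : ℝ) ≤ 1 := by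
      constructor
      · exact_mod_cast Int.emod_nonneg t two_ne_zero
      · have : t % 2 ≤ 1 := by omega
        exact_mod_cast this
    rw [Int.floor_eq_iff]
    constructor <;> linarith [h'.1, h'.2]
  refine (planeDatum_tileOf ((2 : ℝ)⁻¹ • latticeIncl η)).trans ?_
  rw [latticeIncl_apply]
  exact Prod.ext (key _) (key _)

theorem crossSubstitution_map (P : Patch (ℤ × ℤ) Letter) (x y : ℤ) :
    crossSubstitution.map P (x, y) = (P (x / 2, y / 2)).map
      fun t => t.sub (decide (x % 2 = 1)) (decide (y % 2 = 1)) := by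
  have h (η : ℤ × ℤ) : (crossSubstitution.position η).1 =
      -crossSubstitution.latticeDil (crossSubstitution.parent η) + η := rfl
  have hpos : (crossSubstitution.position (x, y)).1 = (x % 2, y % 2) := by
    rw [h, crossSubstitution_latticeDil, crossSubstitution_parent]
    ext1 <;> simp <;> omega
  unfold Substitution.map
  rw [crossSubstitution_parent]
  congr 1
  funext t
  change t.sub (decide ((crossSubstitution.position (x, y)).1.1 % 2 = 1))
    (decide ((crossSubstitution.position (x, y)).1.2 % 2 = 1)) = _
  rw [hpos, Int.emod_emod, Int.emod_emod]

theorem crossSubstitution_latticeDist (γ η : ℤ × ℤ) :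
    crossSubstitution.latticeDist γ η =
      max |(γ.1 : ℝ) - (η.1 : ℝ)| |(γ.2 : ℝ) - (η.2 : ℝ)| := rfl

end

open Letter Tile

/-! ### Iterates of the substitution -/

/-- The letter at the point `(x, y)` of the block `S^n(t)`, extended with period `2 ^ n`. -/
def block : ℕ → Letter → ℤ → ℤ → Letter
  | 0, t, _, _ => t
  | n + 1, t, x, y =>
    (block n t (x / 2) (y / 2)).sub (decide (x % 2 = 1)) (decide (y % 2 = 1))

/-- The support of the block `S^n(t)`. -/
def Inside (n : ℕ) (x y : ℤ) : Prop := (0 ≤ x ∧ x < 2 ^ n) ∧ 0 ≤ y ∧ y < 2 ^ n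

theorem ediv_two_pow_succ (x : ℤ) (n : ℕ) : x / 2 / 2 ^ n = x / 2 ^ (n + 1) := by
  rw [pow_succ', Int.ediv_ediv_of_nonneg zero_le_two]

theorem inside_iff {n : ℕ} {x y : ℤ} : Inside n x y ↔ (x / 2 ^ n, y / 2 ^ n) = (0 : ℤ × ℤ) := by
  have h : (0 : ℤ) < 2 ^ n := by positivity
  rw [Prod.mk_eq_zero, Int.ediv_eq_iff_of_pos h, Int.ediv_eq_iff_of_pos h]
  simp [Inside]

theorem inside_half {n : ℕ} {x y : ℤ} (h : Inside (n + 1) x y) : Inside n (x / 2) (y / 2) := by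
  simp only [Inside, pow_succ] at h ⊢
  omega

theorem map_iterate (n : ℕ) (P : Patch (ℤ × ℤ) Letter) (x y : ℤ) :
    crossSubstitution.map^[n] P (x, y) =
      (P (x / 2 ^ n, y / 2 ^ n)).map fun t => block n t x y := by
  induction n generalizing x y with
  | zero => simp [block]
  | succ n ih =>
    rw [Function.iterate_succ_apply', crossSubstitution_map, ih, Option.map_map,
      ediv_two_pow_succ, ediv_two_pow_succ]
    rfl

theorem map_iterate_letter {n : ℕ} {a b : Letter} {x y : ℤ} :
    crossSubstitution.map^[n] (Patch.letter b) (x, y) = some a ↔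
      Inside n x y ∧ block n b x y = a := by
  rw [map_iterate, inside_iff, Patch.letter]
  split_ifs with h <;> simp [h]

/-- Only the `n` lowest binary digits of the coordinates enter `block n`. -/
theorem block_mul_add (n : ℕ) (t : Letter) (x y i j : ℤ) :
    block n t (2 ^ n * i + x) (2 ^ n * j + y) = block n t x y := by
  induction n generalizing x y with
  | zero => rfl
  | succ n ih =>
    have h (x i : ℤ) : (2 ^ (n + 1) * i + x) / 2 = 2 ^ n * i + x / 2 ∧
        (2 ^ (n + 1) * i + x) % 2 = x % 2 := by
      rw [pow_succ', mul_assoc]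
      omega
    rw [block, (h x i).1, (h x i).2, (h y j).1, (h y j).2, ih]
    rfl

theorem two_pow_mul_add_ediv {n : ℕ} {i x : ℤ} (h : 0 ≤ x) (h' : x < 2 ^ n) :
    (2 ^ n * i + x) / 2 ^ n = i := by
  rw [Int.mul_add_ediv_left _ _ (by positivity), Int.ediv_eq_zero_of_lt h h', add_zero]

/-- S^(n+m) is S^m after S^n: the higher digits select a letter of S^n(t), the `m` lowest ones a
place in its image. -/
theorem block_add (n m : ℕ) (t : Letter) (x y : ℤ) :
    block (n + m) t x y = block m (block n t (x / 2 ^ m) (y / 2 ^ m)) x y := by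
  induction m generalizing x y with
  | zero => simp [block]
  | succ m ih =>
    rw [← add_assoc, block, ih, ediv_two_pow_succ, ediv_two_pow_succ]
    rfl

/-- Two neighbours lie in the same 2 × 2 block, or their parents are neighbours and `HAdj.sub`
applies. -/
theorem hAdj_block {n : ℕ} {t : Letter} {x y : ℤ} (h : Inside n x y) (h' : Inside n (x + 1) y) :
    HAdj (block n t x y) (block n t (x + 1) y) := by
  induction n generalizing x y with
  | zero => simp only [Inside, pow_zero] at h h'; omega
  | succ n ih =>
    rw [block, block]
    rcases Int.emod_two_eq_zero_or_one x with e | e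
    · have e₁ : (x + 1) / 2 = x / 2 := by omega
      have e₂ : (x + 1) % 2 = 1 := by omega
      rw [e, e₁, e₂]
      exact hAdj_sub _ _
    · have e₁ : (x + 1) / 2 = x / 2 + 1 := by omega
      have e₂ : (x + 1) % 2 = 0 := by omega
      have h'' := inside_half h'
      rw [e₁] at h''
      rw [e, e₁, e₂]
      exact (ih (inside_half h) h'').sub _

theorem vAdj_block {n : ℕ} {t : Letter} {x y : ℤ} (h : Inside n x y) (h' : Inside n x (y + 1)) :
    VAdj (block n t x y) (block n t x (y + 1)) := by
  induction n generalizing x y with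
  | zero => simp only [Inside, pow_zero] at h h'; omega
  | succ n ih =>
    rw [block, block]
    rcases Int.emod_two_eq_zero_or_one y with e | e
    · have e₁ : (y + 1) / 2 = y / 2 := by omega
      have e₂ : (y + 1) % 2 = 1 := by omega
      rw [e, e₁, e₂]
      exact vAdj_sub _ _
    · have e₁ : (y + 1) / 2 = y / 2 + 1 := by omega
      have e₂ : (y + 1) % 2 = 0 := by omega
      have h'' := inside_half h'
      rw [e₁] at h''
      rw [e, e₁, e₂]
      exact (ih (inside_half h) h'').sub _

/-! ### Primitivity -/

/-- The letter `a` occurs in `S^n(b)`. -/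
def Occurs (n : ℕ) (b a : Letter) : Prop := ∃ x y, Inside n x y ∧ block n b x y = a

theorem Occurs.isSubpatch {n : ℕ} {a b : Letter} (h : Occurs n b a) :
    (Patch.letter a).IsSubpatch (crossSubstitution.map^[n] (Patch.letter b)) := by
  obtain ⟨x, y, h⟩ := h
  refine ⟨(x, y), fun η c hc => ?_⟩
  unfold Patch.letter at hc
  split_ifs at hc with hη
  rw [hη, add_zero]
  exact map_iterate_letter.2 (Option.some.inj hc ▸ h)

theorem Occurs.refl (a : Letter) : Occurs 0 a a := ⟨0, 0, by simp [Inside], rfl⟩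

theorem Occurs.sub {n : ℕ} {a b : Letter} (h : Occurs n b a) (i j : Bool) :
    Occurs (n + 1) b (a.sub i j) := by
  obtain ⟨x, y, h, rfl⟩ := h
  simp only [Inside] at h
  refine ⟨2 * x + i.toNat, 2 * y + j.toNat, ?_, ?_⟩
  · simp only [Inside, pow_succ]
    cases i <;> cases j <;> simp <;> omega
  · rw [block]
    cases i <;> cases j <;> simp <;> congr 2 <;> omega

theorem Occurs.trans {n m : ℕ} {a b c : Letter} (h : Occurs n c b) (h' : Occurs m b a) :
    Occurs (n + m) c a := by
  induction m generalizing a with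
  | zero =>
    obtain ⟨_, _, _, rfl⟩ := h'
    exact h
  | succ m ih =>
    obtain ⟨x, y, hxy, rfl⟩ := h'
    exact (ih ⟨_, _, inside_half hxy, rfl⟩).sub _ _

/-- The letter that consists of a cross with odd coordinates in a block with parities `a`, `c`. -/
def crossLetter (a c : Bool) : Letter := ⟨true, true, .cross a c, trivial, rfl⟩

/-- The upper right letter of S(t) is a cross that records the parities of `t`, so this letter
reproduces itself there. Hence a letter reached from it stays reachable at all later times. -/
theorem occurs_crossLetter_self (n : ℕ) :
    Occurs n (crossLetter true true) (crossLetter true true) := by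
  induction n with
  | zero => exact .refl _
  | succ n ih => exact ih.sub true true

/-- The letter `t` occurs in `S^n` of the letter `crossLetter true true`, where `n` is any number
not smaller than `k`. -/
def ReachedBy (k : ℕ) (t : Letter) : Prop := ∀ n, k ≤ n → Occurs n (crossLetter true true) t

theorem ReachedBy.mono {k l : ℕ} {t : Letter} (h : ReachedBy k t) (hkl : k ≤ l) : ReachedBy l t :=
  fun n hn => h n (hkl.trans hn)

theorem ReachedBy.sub {k : ℕ} {t : Letter} (h : ReachedBy k t) (i j : Bool) :
    ReachedBy (k + 1) (t.sub i j) := fun n hn => by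
  obtain ⟨m, rfl⟩ := Nat.exists_eq_add_of_le' hn
  exact (h (m + k) (by omega)).sub i j

theorem reachedBy_crossLetter_true : ReachedBy 0 (crossLetter true true) :=
  fun n _ => occurs_crossLetter_self n

theorem reachedBy_crossLetter (a c : Bool) : ReachedBy 2 (crossLetter a c) := by
  have h := (reachedBy_crossLetter_true.sub a c).sub true true
  cases a <;> cases c <;> exact h

/-- Colours that point right come from crosses, those that point left from vertical lines. The odd
second parity is what `reachedBy_horiz` needs when `c` is true. -/
theorem exists_reachedBy_east (h : Color) :
    ∃ t, ReachedBy 2 t ∧ t.px = h.1 ∧ t.py = true ∧ t.tile.east = h := by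
  obtain ⟨d, a, c⟩ := h
  cases d
  · refine ⟨_, (reachedBy_crossLetter_true.sub a c).sub false true, rfl, rfl, ?_⟩
    cases a <;> cases c <;> rfl
  · exact ⟨_, reachedBy_crossLetter a c, rfl, rfl, rfl⟩

theorem exists_reachedBy_north (v : Color) :
    ∃ t, ReachedBy 2 t ∧ t.px = true ∧ t.py = v.1 ∧ t.tile.north = v := by
  obtain ⟨d, a, c⟩ := v
  cases d
  · refine ⟨_, (reachedBy_crossLetter_true.sub a c).sub true false, rfl, rfl, ?_⟩
    cases a <;> cases c <;> rfl
  · exact ⟨_, reachedBy_crossLetter a c, rfl, rfl, rfl⟩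

theorem reachedBy_horiz {h : Color} {a c : Bool} (hl : (horiz h a c).Legal) :
    ReachedBy 4 ⟨true, false, horiz h a c, hl, rfl⟩ := by
  obtain ⟨t, ht, hx, hy, he⟩ : ∃ t, ReachedBy 3 t ∧ t.px = a ∧ t.py = c ∧ t.tile.east = h := by
    obtain ⟨t, ht, hx, hy, he⟩ := exists_reachedBy_east h
    -- For even `c`, the lower row of S(t) repeats the right edge of `t` with both values of the
    -- first parity. For odd `c`, legality says that `t` already has first parity `a`.
    cases c
    · cases a
      · exact ⟨_, ht.sub false false, rfl, rfl, he⟩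
      · exact ⟨_, ht.sub true false, rfl, rfl, he⟩
    · exact ⟨t, ht.mono (by norm_num), hx.trans (hl rfl), hy, he⟩
  subst hx hy he
  exact ht.sub true false

theorem reachedBy_vert {v : Color} {a c : Bool} (hl : (vert v a c).Legal) :
    ReachedBy 4 ⟨false, true, vert v a c, hl, rfl⟩ := by
  obtain ⟨t, ht, hx, hy, he⟩ : ∃ t, ReachedBy 3 t ∧ t.px = a ∧ t.py = c ∧ t.tile.north = v := by
    obtain ⟨t, ht, hx, hy, he⟩ := exists_reachedBy_north v
    cases a
    · cases c
      · exact ⟨_, ht.sub false false, rfl, rfl, he⟩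
      · exact ⟨_, ht.sub false true, rfl, rfl, he⟩
    · exact ⟨t, ht.mono (by norm_num), hx, hy.trans (hl rfl), he⟩
  subst hx hy he
  exact ht.sub false true

theorem reachedBy_all (t : Letter) : ReachedBy 5 t := by
  obtain ⟨px, py, s, hl, hf⟩ := t
  cases s with
  | cross a c =>
    obtain rfl : px = py := hf
    cases px
    · exact ((reachedBy_crossLetter a c).sub false false).mono (by norm_num)
    · exact (reachedBy_crossLetter a c).mono (by norm_num)
  | vert v a c =>
    obtain rfl : px = false := hf
    cases py
    · exact (reachedBy_vert hl).sub false false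
    · exact (reachedBy_vert hl).mono (by norm_num)
  | horiz h a c =>
    obtain rfl : py = false := hf
    cases px
    · exact (reachedBy_horiz hl).sub false false
    · exact (reachedBy_horiz hl).mono (by norm_num)

/-- Passing twice to the upper right letter turns any letter into `crossLetter true true`; five more
steps reach everything. -/
theorem occurs_seven (b a : Letter) : Occurs 7 b a :=
  (((Occurs.refl b).sub true true).sub true true).trans (reachedBy_all a 5 le_rfl)

theorem crossSubstitution_isPrimitive : crossSubstitution.IsPrimitive :=
  ⟨7, by norm_num, fun a b => (occurs_seven b a).isSubpatch⟩

/-! ### The subshift -/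

theorem mem_subshift_iff {ω : Config (ℤ × ℤ) Letter} :
    ω ∈ crossSubstitution.subshift ↔ ∀ F : Finset (ℤ × ℤ), ∃ n, 1 ≤ n ∧ ∃ t i j, ∀ x y,
      (x, y) ∈ F → Inside n (i + x) (j + y) ∧ block n t (i + x) (j + y) = ω (x, y) := by
  classical
  constructor
  · intro h F
    have hP : (fun η => if η ∈ F then some (ω η) else none : Patch (ℤ × ℤ) Letter) ∈
        dictionary ω := by
      refine ⟨F.finite_toSet.subset fun η hη => ?_, 0, fun η a ha => ?_⟩
      · by_contra h'
        exact hη (if_neg h')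
      · replace ha : (if η ∈ F then some (ω η) else none) = some a := ha
        split_ifs at ha
        rw [zero_add]
        exact ha
    obtain ⟨-, n, hn, t, ⟨i, j⟩, hij⟩ := h hP
    exact ⟨n, hn, t, i, j, fun x y hxy => map_iterate_letter.1 (hij (x, y) _ (if_pos hxy))⟩
  · rintro h P ⟨hfin, ⟨u, v⟩, huv⟩
    obtain ⟨n, hn, t, i, j, hij⟩ := h (hfin.toFinset.image fun η => (u, v) + η)
    refine ⟨hfin, n, hn, t, (i + u, j + v), ?_⟩
    rintro ⟨x, y⟩ a ha
    have hmem : (x, y) ∈ hfin.toFinset := by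
      rw [Set.Finite.mem_toFinset]
      intro h'
      rw [h'] at ha
      cases ha
    have h' := hij (u + x) (v + y) (Finset.mem_image_of_mem _ hmem)
    have ha' : ω (u + x, v + y) = a := Option.some.inj (huv _ _ ha)
    rw [ha', ← add_assoc, ← add_assoc] at h'
    exact map_iterate_letter.2 h'

theorem admissible_of_mem_subshift {ω : Config (ℤ × ℤ) Letter}
    (h : ω ∈ crossSubstitution.subshift) : Admissible ω := by
  rw [mem_subshift_iff] at h
  constructor <;> intro x y
  · obtain ⟨n, -, t, i, j, hij⟩ := h {(x, y), (x + 1, y)}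
    obtain ⟨h₁, e₁⟩ := hij x y (by simp)
    obtain ⟨h₂, e₂⟩ := hij (x + 1) y (by simp)
    rw [← e₁, ← e₂]
    rw [← add_assoc] at h₂ ⊢
    exact hAdj_block h₁ h₂
  · obtain ⟨n, -, t, i, j, hij⟩ := h {(x, y), (x, y + 1)}
    obtain ⟨h₁, e₁⟩ := hij x y (by simp)
    obtain ⟨h₂, e₂⟩ := hij x (y + 1) (by simp)
    rw [← e₁, ← e₂]
    rw [← add_assoc] at h₂ ⊢
    exact vAdj_block h₁ h₂

/-- The coordinates of the cross in the centre of the blocks `S^(2n)`. -/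
def centre : ℕ → ℤ
  | 0 => 0
  | n + 1 => 4 ^ n + centre n

theorem three_mul_centre (n : ℕ) : 3 * centre n = 4 ^ n - 1 := by
  induction n with
  | zero => rfl
  | succ n ih => rw [centre, mul_add, ih]; ring

theorem le_centre (n : ℕ) : (n : ℤ) ≤ centre n := by
  induction n with
  | zero => rfl
  | succ n ih =>
    have : (1 : ℤ) ≤ 4 ^ n := one_le_pow₀ (by norm_num)
    rw [centre]
    push_cast
    linarith

theorem inside_centre {n : ℕ} {x y : ℤ} (hx : |x| ≤ n) (hy : |y| ≤ n) :
    Inside (2 * n) (centre n + x) (centre n + y) := by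
  have h₁ := three_mul_centre n
  have h₂ := le_centre n
  rw [abs_le] at hx hy
  rw [Inside, pow_mul]
  norm_num
  omega

/-- The even cross `crossLetter false false` occurs at (1, 1) in its own 4 × 4 image under S².
Passing to `centre (n + 1)` prefixes the binary digits 01, which select that copy. -/
theorem block_centre_succ {n : ℕ} {x y : ℤ} (hx : |x| ≤ n) (hy : |y| ≤ n) :
    block (2 * (n + 1)) (crossLetter false false) (centre (n + 1) + x) (centre (n + 1) + y) =
      block (2 * n) (crossLetter false false) (centre n + x) (centre n + y) := by
  obtain ⟨⟨h₁, h₂⟩, h₃, h₄⟩ := inside_centre hx hy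
  have h : (4 : ℤ) ^ n = 2 ^ (2 * n) * 1 := by rw [pow_mul]; norm_num
  rw [show 2 * (n + 1) = 2 + 2 * n by ring, block_add, centre, add_assoc, add_assoc, h,
    two_pow_mul_add_ediv h₁ h₂, two_pow_mul_add_ediv h₃ h₄, block_mul_add]
  rfl

theorem block_centre_eq {k n : ℕ} (hkn : k ≤ n) {x y : ℤ} (hx : |x| ≤ k) (hy : |y| ≤ k) :
    block (2 * n) (crossLetter false false) (centre n + x) (centre n + y) =
      block (2 * k) (crossLetter false false) (centre k + x) (centre k + y) := by
  induction n, hkn using Nat.le_induction with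
  | base => rfl
  | succ n hkn ih =>
    have : (k : ℤ) ≤ n := by exact_mod_cast hkn
    rw [block_centre_succ (hx.trans this) (hy.trans this), ih]

/-- The nested blocks S^(2n) around `centre n` exhaust the plane; each value is read from a block
large enough to contain its place. -/
theorem subshift_nonempty : crossSubstitution.subshift.Nonempty := by
  refine ⟨fun η => block (2 * (η.1.natAbs + η.2.natAbs)) (crossLetter false false)
    (centre (η.1.natAbs + η.2.natAbs) + η.1) (centre (η.1.natAbs + η.2.natAbs) + η.2),
    mem_subshift_iff.2 fun F => ?_⟩
  set n := F.sup fun η => η.1.natAbs + η.2.natAbs with hn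
  -- The summand 1 keeps the exponent positive when `n = 0`.
  refine ⟨2 * (n + 1), by omega, crossLetter false false, centre (n + 1), centre (n + 1),
    fun x y hxy => ?_⟩
  have hle : x.natAbs + y.natAbs ≤ n :=
    Finset.le_sup (f := fun η : ℤ × ℤ => η.1.natAbs + η.2.natAbs) hxy
  refine ⟨inside_centre ?_ ?_, block_centre_eq (by omega) ?_ ?_⟩ <;>
    rw [Int.abs_eq_natAbs] <;> omega

/-! ### Minimality -/

theorem mem_closure_pi_iff_of_discrete {ι A : Type} [TopologicalSpace A] [DiscreteTopology A]
    {s : Set (ι → A)} {f : ι → A} :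
    f ∈ closure s ↔ ∀ F : Finset ι, ∃ g ∈ s, ∀ i ∈ F, g i = f i := by
  rw [mem_closure_iff]
  constructor
  · intro h F
    obtain ⟨g, h₁, h₂⟩ := h ((F : Set ι).pi fun i => {f i})
      (isOpen_set_pi F.finite_toSet fun _ _ => isOpen_discrete _) fun _ _ => rfl
    exact ⟨g, h₂, fun i hi => h₁ i hi⟩
  · intro h o ho hf
    obtain ⟨F, u, hu, hsub⟩ := isOpen_pi_iff.1 ho f hf
    obtain ⟨g, h₁, h₂⟩ := h F
    exact ⟨g, hsub fun i hi => by rw [h₂ i hi]; exact (hu i hi).2, h₁⟩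

/-- A configuration is in the closure of a set if and only if it agrees on each finite set with
some configuration in the set. -/
theorem mem_closure_config_iff {Γ A : Type} {s : Set (Config Γ A)} {ω : Config Γ A} :
    ω ∈ closure s ↔ ∀ F : Finset Γ, ∃ ρ ∈ s, ∀ η ∈ F, ρ η = ω η :=
  @mem_closure_pi_iff_of_discrete Γ A ⊥ (@DiscreteTopology.mk A ⊥ rfl) s ω

theorem isSubshift_subshift : IsSubshift crossSubstitution.subshift where
  nonempty := subshift_nonempty
  closed := by
    refine isClosed_of_closure_subset fun ω hω => mem_subshift_iff.2 fun F => ?_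
    obtain ⟨ρ, hρ, h⟩ := mem_closure_config_iff.1 hω F
    obtain ⟨n, hn, t, i, j, hij⟩ := mem_subshift_iff.1 hρ F
    exact ⟨n, hn, t, i, j, fun x y hxy => h _ hxy ▸ hij x y hxy⟩
  invariant := by
    rintro ⟨u, v⟩ ω hω
    refine mem_subshift_iff.2 fun F => ?_
    obtain ⟨n, hn, t, i, j, hij⟩ := mem_subshift_iff.1 hω (F.image fun η => -(u, v) + η)
    refine ⟨n, hn, t, i - u, j - v, fun x y hxy => ?_⟩
    have h := hij (-u + x) (-v + y) (Finset.mem_image_of_mem _ hxy)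
    rw [← add_assoc, ← add_assoc, ← sub_eq_add_neg, ← sub_eq_add_neg] at h
    exact h

/-- Every block occurs in every configuration of the subshift. -/
theorem exists_block_of_mem_subshift {ω : Config (ℤ × ℤ) Letter}
    (h : ω ∈ crossSubstitution.subshift) (n : ℕ) (t : Letter) :
    ∃ i j, ∀ x y, Inside n x y → ω (i + x, j + y) = block n t x y := by
  -- A window of side 2 ^ (N + 1) contains a full cell of the grid of mesh 2 ^ N. The cell carries
  -- S^N of some letter, and S^7 of that letter contains `t`.
  set N := 7 + n with hN
  obtain ⟨m, -, c, i, j, hij⟩ := mem_subshift_iff.1 h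
    ((Finset.Ico 0 (2 ^ (N + 1))) ×ˢ (Finset.Ico 0 (2 ^ (N + 1))))
  simp only [Finset.mem_product, Finset.mem_Ico] at hij
  have hpos : (0 : ℤ) < 2 ^ N := by positivity
  have hsucc : (2 : ℤ) ^ (N + 1) = 2 * 2 ^ N := pow_succ' _ _
  have hNm : N ≤ m := by
    have h₁ := (hij 0 0 (by omega)).1.1
    have h₂ := (hij (2 ^ (N + 1) - 1) 0 (by omega)).1.1
    by_contra hlt
    have : (2 : ℤ) ^ m ≤ 2 ^ N := pow_le_pow_right₀ one_le_two (by omega)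
    omega
  obtain ⟨k, rfl⟩ := Nat.exists_eq_add_of_le' hNm
  have hceil (i : ℤ) : ∃ p, 0 ≤ 2 ^ N * p - i ∧ 2 ^ N * p - i < 2 ^ N := by
    -- This is the ceiling of i / 2 ^ N.
    refine ⟨-(-i / 2 ^ N), ?_⟩
    have h₁ := Int.mul_ediv_add_emod (-i) (2 ^ N)
    have h₂ := Int.emod_nonneg (-i) hpos.ne'
    have h₃ := Int.emod_lt_of_pos (-i) hpos
    rw [mul_neg]
    omega
  obtain ⟨p, hp⟩ := hceil i
  obtain ⟨q, hq⟩ := hceil j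
  obtain ⟨u, v, huv, ht⟩ := occurs_seven (block k c p q) t
  refine ⟨2 ^ N * p - i + 2 ^ n * u, 2 ^ N * q - j + 2 ^ n * v, fun x y hxy => ?_⟩
  have hin : Inside N (2 ^ n * u + x) (2 ^ n * v + y) := by
    have e : (2 : ℤ) ^ N = 2 ^ n * 128 := by rw [hN, pow_add, mul_comm]; norm_num
    obtain ⟨⟨_, _⟩, _, _⟩ := hxy
    obtain ⟨⟨_, _⟩, _, _⟩ := huv
    simp only [Inside, e]
    refine ⟨⟨?_, ?_⟩, ?_, ?_⟩ <;> nlinarith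
  obtain ⟨⟨h₁, h₂⟩, h₃, h₄⟩ := hin
  have hω := (hij (2 ^ N * p - i + 2 ^ n * u + x) (2 ^ N * q - j + 2 ^ n * v + y) (by omega)).2
  rw [← hω, show i + (2 ^ N * p - i + 2 ^ n * u + x) = 2 ^ N * p + (2 ^ n * u + x) by ring,
    show j + (2 ^ N * q - j + 2 ^ n * v + y) = 2 ^ N * q + (2 ^ n * v + y) by ring, block_add,
    two_pow_mul_add_ediv h₁ h₂, two_pow_mul_add_ediv h₃ h₄, block_mul_add, hN, block_add,
    two_pow_mul_add_ediv hxy.1.1 hxy.1.2, two_pow_mul_add_ediv hxy.2.1 hxy.2.2, ht, block_mul_add]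

theorem isMinimalSubshift_subshift : IsMinimalSubshift crossSubstitution.subshift := by
  refine ⟨isSubshift_subshift, fun ω hω => Subset.antisymm ?_ fun ρ hρ => ?_⟩
  · refine closure_minimal ?_ isSubshift_subshift.closed
    rintro _ ⟨γ, rfl⟩
    exact isSubshift_subshift.invariant γ ω hω
  · refine mem_closure_config_iff.2 fun F => ?_
    obtain ⟨n, -, t, i, j, hij⟩ := mem_subshift_iff.1 hρ F
    obtain ⟨u, v, huv⟩ := exists_block_of_mem_subshift hω n t
    refine ⟨_, ⟨-(u + i, v + j), rfl⟩, ?_⟩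
    rintro ⟨x, y⟩ hxy
    obtain ⟨h₁, h₂⟩ := hij x y hxy
    rw [← h₂, ← huv _ _ h₁]
    simp [translate, add_assoc]

theorem translate_eq_self {ω : Config (ℤ × ℤ) Letter} (hω : Admissible ω) {γ : ℤ × ℤ}
    (h : translate γ ω = ω) : γ = 0 := by
  have := hω.period_eq_zero (u := -γ.1) (v := -γ.2) fun x y => congrFun h (x, y)
  exact Prod.ext (neg_eq_zero.1 this.1) (neg_eq_zero.1 this.2)

theorem isStronglyAperiodic_subshift : IsStronglyAperiodic crossSubstitution.subshift := by
  intro ω hω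
  ext γ
  refine ⟨translate_eq_self (admissible_of_mem_subshift hω), ?_⟩
  rintro rfl
  funext η
  simp [translate]

/-! ### Periodic approximations -/

section Distance

variable {Γ A : Type} (d : Γ → Γ → ℝ)

theorem mem_lowerBounds_configDist [AddGroup Γ] (ω ρ : Config Γ A) :
    0 ∈ lowerBounds {t | ∃ r : ℝ, 0 ≤ r ∧ (∀ γ : Γ, d γ 0 < r → ω γ = ρ γ) ∧ t = 1 / (r + 1)} := by
  rintro _ ⟨r, hr, -, rfl⟩
  positivity

theorem nonempty_configDist [AddGroup Γ] (hd : ∀ γ, 0 ≤ d γ 0) (ω ρ : Config Γ A) :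
    1 ∈ {t | ∃ r : ℝ, 0 ≤ r ∧ (∀ γ : Γ, d γ 0 < r → ω γ = ρ γ) ∧ t = 1 / (r + 1)} :=
  ⟨0, le_rfl, fun γ hγ => absurd hγ (hd γ).not_gt, by norm_num⟩

variable [AddGroup Γ] {d}

theorem configDist_nonneg (ω ρ : Config Γ A) : 0 ≤ configDist d ω ρ :=
  Real.sInf_nonneg (mem_lowerBounds_configDist d ω ρ)

theorem configDist_le_one (hd : ∀ γ, 0 ≤ d γ 0) (ω ρ : Config Γ A) : configDist d ω ρ ≤ 1 :=
  csInf_le ⟨0, mem_lowerBounds_configDist d ω ρ⟩ (nonempty_configDist d hd ω ρ)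

/-- Configurations at distance less than `1 / (R + 1)` agree on the closed ball of radius `R`. -/
theorem eq_of_configDist_lt (hd : ∀ γ, 0 ≤ d γ 0) {ω ρ : Config Γ A} {R : ℝ} (hR : 0 ≤ R)
    (h : configDist d ω ρ < 1 / (R + 1)) {γ : Γ} (hγ : d γ 0 ≤ R) : ω γ = ρ γ := by
  obtain ⟨_, ⟨r, hr, hag, rfl⟩, hlt⟩ :=
    exists_lt_of_csInf_lt ⟨1, nonempty_configDist d hd ω ρ⟩ h
  rw [one_div_lt_one_div (by positivity) (by positivity)] at hlt
  exact hag γ (by linarith)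

theorem exists_configDist_lt_of_configHausdorffDist_lt (hd : ∀ γ, 0 ≤ d γ 0)
    {Ω₁ Ω₂ : Set (Config Γ A)} (hne : Ω₂.Nonempty) {ε : ℝ}
    (h : configHausdorffDist d Ω₁ Ω₂ < ε) {ω : Config Γ A} (hω : ω ∈ Ω₁) :
    ∃ ρ ∈ Ω₂, configDist d ω ρ < ε := by
  have : Nonempty Ω₂ := hne.to_subtype
  -- Needed because a real supremum of an unbounded family is 0 by convention.
  have hbdd : BddAbove (range fun ω : Ω₁ => ⨅ ρ : Ω₂, configDist d ω.1 ρ.1) := by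
    refine ⟨1, ?_⟩
    rintro _ ⟨ω, rfl⟩
    refine (ciInf_le ⟨0, ?_⟩ (Classical.arbitrary Ω₂)).trans (configDist_le_one hd _ _)
    rintro _ ⟨ρ, rfl⟩
    exact configDist_nonneg _ _
  obtain ⟨ρ, hρ⟩ := exists_lt_of_ciInf_lt
    ((le_ciSup hbdd ⟨ω, hω⟩).trans_lt ((le_max_left _ _).trans_lt h))
  exact ⟨ρ.1, ρ.2, hρ⟩

end Distance

/-- Whether a configuration is admissible can be seen from its translates near the origin. -/
theorem admissible_of_translates {ω : Config (ℤ × ℤ) Letter}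
    (h : ∀ γ, ∃ ρ, Admissible ρ ∧ translate γ ω (0, 0) = ρ (0, 0) ∧
      translate γ ω (1, 0) = ρ (1, 0) ∧ translate γ ω (0, 1) = ρ (0, 1)) : Admissible ω := by
  constructor <;> intro x y <;> obtain ⟨ρ, hρ, h₀, h₁, h₂⟩ := h (-(x, y))
  · have := hρ.1 0 0
    rw [zero_add, ← h₀, ← h₁] at this
    simpa [translate] using this
  · have := hρ.2 0 0
    rw [zero_add, ← h₀, ← h₂] at this
    simpa [translate] using this

/-- An admissible configuration has an infinite orbit. -/
theorem Admissible.not_isPeriodic {ω : Config (ℤ × ℤ) Letter} (hω : Admissible ω) :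
    ¬ IsPeriodic ω := by
  intro hfin
  have : Finite (orbit ω) := hfin
  obtain ⟨γ, γ', hne, h⟩ := Finite.exists_ne_map_eq_of_infinite
    fun γ : ℤ × ℤ => (⟨translate γ ω, γ, rfl⟩ : orbit ω)
  have h' : translate γ ω = translate γ' ω := congrArg Subtype.val h
  refine hne (sub_eq_zero.1 (translate_eq_self hω (γ := γ - γ') ?_))
  funext η
  have := congrFun h' (γ' + η)
  simp only [translate, neg_add_cancel_left] at this ⊢
  rw [← this]
  congr 1
  abel

/-- Only one half of the Hausdorff distance matters: each point of the finite orbit is close to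
Ω(S). -/
theorem not_isPeriodicallyApproximable_subshift :
    ¬ IsPeriodicallyApproximable crossSubstitution.latticeDist crossSubstitution.subshift := by
  rintro ⟨ω, hper, hlim⟩
  have hd : ∀ γ, 0 ≤ crossSubstitution.latticeDist γ 0 := fun γ => dist_nonneg
  -- Below 1 / (1 + 1), configurations agree on the closed unit ball, which contains (0, 0), (1, 0)
  -- and (0, 1).
  obtain ⟨n, hn⟩ := (hlim.eventually_lt_const (show (0 : ℝ) < 1 / (1 + 1) by norm_num)).exists
  refine Admissible.not_isPeriodic (admissible_of_translates fun γ => ?_) (hper n)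
  obtain ⟨ρ, hρ, hdist⟩ := exists_configDist_lt_of_configHausdorffDist_lt hd subshift_nonempty hn
    (show translate γ (ω n) ∈ orbit (ω n) from ⟨γ, rfl⟩)
  refine ⟨ρ, admissible_of_mem_subshift hρ, ?_, ?_, ?_⟩ <;>
    refine eq_of_configDist_lt hd zero_le_one hdist ?_ <;>
    rw [crossSubstitution_latticeDist] <;> simp

end SymbolicSubstitution

theorem mainTheorem4 :
    ∃ (A : Type) (σ : SymbolicSubstitution.Substitution (ℤ × ℤ) A),
      σ.IsPrimitive ∧
      SymbolicSubstitution.IsMinimalSubshift σ.subshift ∧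
      SymbolicSubstitution.IsStronglyAperiodic σ.subshift ∧
      ¬ SymbolicSubstitution.IsPeriodicallyApproximable σ.latticeDist σ.subshift :=
  ⟨SymbolicSubstitution.Letter, SymbolicSubstitution.crossSubstitution,
    SymbolicSubstitution.crossSubstitution_isPrimitive,
    SymbolicSubstitution.isMinimalSubshift_subshift,
    SymbolicSubstitution.isStronglyAperiodic_subshift,
    SymbolicSubstitution.not_isPeriodicallyApproximable_subshift⟩
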